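/- Let $m>1$ be an integer and let $\wp$ be an odd prime such that $3$ is a primitive root modulo $\wp^m$. Put $q=3^{\phi(\wp^m)}$, where $\phi$ is Euler's totient function, let $\mathrm{Tr}$ be the trace from $\mathbb{F}_q$ onto $\mathbb{F}_3$, let $$D=\{x\in\mathbb{F}_q^*:\ \mathrm{Tr}(x^{(q-1)/\wp^m})=0\}=\{d_1,\dots,d_n\}\qquad(n=\#D),$$ and let $\mathcal{C}_D=\{(\mathrm{Tr}(d_1x),\dots,\mathrm{Tr}(d_nx)):\ x\in\mathbb{F}_q\}\subseteq\mathbb{F}_3^n$. Then the dual code $\mathcal{C}_D^{\perp}$ of $\mathcal{C}_D$ (with respect to the standard inner product on $\mathbb{F}_3^n$) is a ternary $[n,\ n-\wp^{m-1}(\wp-1),\ 2]$ linear code, i.e. it has length $n$, dimension $n-\wp^{m-1}(\wp-1)$ and minimum Hamming distance exactly $2$, where $$n=\begin{cases}\dfrac{(q-1)(\wp^m-\wp+1)}{\wp^m},&\text{if }\wp\equiv 1\pmod 3,\\[2mm]\dfrac{(q-1)(\wp^m-\wp)}{\wp^m},&\text{if }\wp\equiv -1\pmod 3.\end{cases}$$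 -/

import Mathlib

namespace TernaryCode

/-- The defining set `D = {x ∈ F^* : Tr (x ^ ((q - 1) / N)) = 0}`, where `q = #F` and `Tr` is the
trace from `F` to `𝔽₃`.  (It is used only when `N ∣ q - 1`, so the division is exact.) -/
def definingSet (F : Type*) [Field F] [Algebra (ZMod 3) F] (N : ℕ) : Set F :=
  {x | x ≠ 0 ∧ Algebra.trace (ZMod 3) F (x ^ ((Nat.card F - 1) / N)) = 0}

/-- The code `{(Tr (d₁ x), …, Tr (dₙ x)) : x ∈ F}` over `𝔽₃` attached to `d₁, …, dₙ ∈ F`. -/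
noncomputable def traceCode {F : Type*} [Field F] [Algebra (ZMod 3) F] {n : ℕ} (d : Fin n → F) :
    Submodule (ZMod 3) (Fin n → ZMod 3) :=
  LinearMap.range
    (LinearMap.pi fun i => Algebra.trace (ZMod 3) F ∘ₗ LinearMap.mulLeft (ZMod 3) (d i))

theorem mem_traceCode {F : Type*} [Field F] [Algebra (ZMod 3) F] {n : ℕ} (d : Fin n → F)
    (c : Fin n → ZMod 3) :
    c ∈ traceCode d ↔ ∃ x : F, c = fun i => Algebra.trace (ZMod 3) F (d i * x) := by
  constructor
  · rintro ⟨x, rfl⟩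
    exact ⟨x, rfl⟩
  · rintro ⟨x, rfl⟩
    exact ⟨x, rfl⟩

/-- The dual code: all words orthogonal to every codeword for the standard inner product. -/
def dualCode {K : Type*} [Field K] {n : ℕ} (C : Submodule K (Fin n → K)) :
    Submodule K (Fin n → K) where
  carrier := {v | ∀ c ∈ C, v ⬝ᵥ c = 0}
  zero_mem' := fun c _ => zero_dotProduct c
  add_mem' := fun {u v} hu hv c hc => by rw [add_dotProduct, hu c hc, hv c hc, add_zero]
  smul_mem' := fun a v hv c hc => by rw [smul_dotProduct, hv c hc, smul_zero]

/-- `C ⊆ Kⁿ` is an `[n, k, d]` linear code: it has dimension `k`, and `d` is the minimum of the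
Hamming distances between distinct codewords (in particular such codewords exist). -/
def IsLinearCode {K : Type*} [Field K] [DecidableEq K] (n k d : ℕ)
    (C : Submodule K (Fin n → K)) : Prop :=
  Module.finrank K C = k ∧
    IsLeast {w : ℕ | ∃ c ∈ C, ∃ c' ∈ C, c ≠ c' ∧ hammingDist c c' = w} d

end TernaryCode

/-! Let `N = ℓ ^ (s + 1)` and `η ^ N = 1`. As 3 is a primitive root, the Frobenius conjugates of `η`
are its powers with exponent prime to `N`, so the trace is the full geometric sum minus the one over
multiples of `ℓ`: `N·[η = 1] - ℓ ^ s·[η ^ ℓ = 1]` in characteristic 3. Its zeros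
(`trace_eq_zero_iff`) are counted in the cyclic group `Fˣ`, giving `n`. Since `3 * n > q`, `D` lies
in no trace hyperplane, which fixes the dimension. Dual words are the linear relations among the `d
i`: these are nonzero, so weight 1 is impossible, while `x` and `-x` both lie in `D`, giving weight
2. -/

theorem sum_pow_pow_eq_sum_coprime {R : Type*} [CommRing R] {g N : ℕ} (hN : 0 < N)
    (hg : orderOf (g : ZMod N) = N.totient) {η : R} (hη : η ^ N = 1) :
    ∑ i ∈ Finset.range N.totient, η ^ g ^ i =
      ∑ j ∈ Finset.range N with N.Coprime j, η ^ j := by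
  have hpos : 0 < N.totient := Nat.totient_pos.2 hN
  have hunit : IsUnit (g : ZMod N) :=
    (isOfFinOrder_iff_pow_eq_one.2 ⟨N.totient, hpos, by rw [← hg, pow_orderOf_eq_one]⟩).isUnit
  have hcop : Nat.Coprime N g := ((ZMod.isUnit_iff_coprime g N).1 hunit).symm
  have hinj : Set.InjOn (fun i => g ^ i % N) (Finset.range N.totient : Set ℕ) := by
    intro i hi j hj hij
    have h : (g : ZMod N) ^ i = (g : ZMod N) ^ j := by
      have := (ZMod.natCast_eq_natCast_iff' (g ^ i) (g ^ j) N).2 hij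
      simpa using this
    refine pow_injOn_Iio_orderOf (Set.mem_Iio.2 (hg ▸ ?_)) (Set.mem_Iio.2 (hg ▸ ?_)) h 
    · exact Finset.mem_range.1 hi
    · exact Finset.mem_range.1 hj
  have himg : (Finset.range N.totient).image (fun i => g ^ i % N) =
      {j ∈ Finset.range N | N.Coprime j} := by
    refine Finset.eq_of_subset_of_card_le ?_ ?_
    · intro j hj
      obtain ⟨i, -, rfl⟩ := Finset.mem_image.1 hj
      refine Finset.mem_filter.2 ⟨Finset.mem_range.2 (Nat.mod_lt _ hN), ?_⟩
      rw [Nat.coprime_iff_gcd_eq_one, Nat.gcd_comm, ← Nat.gcd_rec]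
      exact hcop.pow_right i
    · rw [← Nat.totient_eq_card_coprime, Finset.card_image_of_injOn hinj, Finset.card_range]
  rw [← himg, Finset.sum_image hinj]
  exact Finset.sum_congr rfl fun i _ => pow_eq_pow_mod _ hη

theorem sum_coprime_prime_pow_add {R : Type*} [CommRing R] {ℓ : ℕ} (hℓ : ℓ.Prime) (s : ℕ) (η : R) :
    ∑ j ∈ Finset.range (ℓ ^ (s + 1)) with (ℓ ^ (s + 1)).Coprime j, η ^ j +
      ∑ j ∈ Finset.range (ℓ ^ s), (η ^ ℓ) ^ j = ∑ j ∈ Finset.range (ℓ ^ (s + 1)), η ^ j := by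
  rw [← Finset.sum_filter_add_sum_filter_not (Finset.range (ℓ ^ (s + 1)))
    (fun j => (ℓ ^ (s + 1)).Coprime j)]
  congr 1
  refine Finset.sum_bij (fun j _ => ℓ * j) ?_ ?_ ?_ ?_
  · intro j hj
    rw [Finset.mem_range] at hj
    simp only [Finset.mem_filter, Finset.mem_range]
    refine ⟨?_, ?_⟩
    · rw [pow_succ']
      exact Nat.mul_lt_mul_of_pos_left hj hℓ.pos
    · rw [Nat.coprime_pow_left_iff s.succ_pos, hℓ.coprime_iff_not_dvd, not_not]
      exact dvd_mul_right _ _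
  · intro i _ j _ h
    exact Nat.eq_of_mul_eq_mul_left hℓ.pos h
  · intro j hj
    simp only [Finset.mem_filter, Finset.mem_range] at hj
    rw [Nat.coprime_pow_left_iff s.succ_pos, hℓ.coprime_iff_not_dvd, not_not] at hj
    obtain ⟨hlt, k, rfl⟩ := hj
    rw [pow_succ'] at hlt
    exact ⟨k, Finset.mem_range.2 (Nat.lt_of_mul_lt_mul_left hlt), rfl⟩
  · intro j _
    rw [pow_mul]

theorem geom_sum_of_pow_eq_one {K : Type*} [Field K] [DecidableEq K] {x : K} {n : ℕ}
    (hx : x ^ n = 1) :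
    ∑ i ∈ Finset.range n, x ^ i = if x = 1 then (n : K) else 0 := by
  split_ifs with h
  · simp [h]
  · rw [geom_sum_eq h, hx, sub_self, zero_div]

theorem ZMod.natCast_sub_one_eq_zero_iff (ℓ : ℕ) : (ℓ : ZMod 3) - 1 = 0 ↔ ℓ ≡ 1 [MOD 3] := by
  rw [← ZMod.natCast_eq_natCast_iff, Nat.cast_one, sub_eq_zero]

theorem FiniteField.natCard_pow_eq_one {F : Type*} [Field F] [Finite F] {k : ℕ}
    (hk : k ∣ Nat.card F - 1) :
    Nat.card {u : Fˣ // u ^ k = 1} = k := by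
  have := IsCyclic.card_powMonoidHom_ker Fˣ k
  rw [Nat.card_units, Nat.gcd_eq_right hk] at this
  exact this

namespace TernaryCode

variable {F : Type*} [Field F] [Finite F] [Algebra (ZMod 3) F]

theorem finrank_eq_of_natCard {k : ℕ} (hF : Nat.card F = 3 ^ k) :
    Module.finrank (ZMod 3) F = k := by
  have h := Module.natCard_eq_pow_finrank (K := ZMod 3) (V := F)
  rw [hF, Nat.card_zmod] at h
  exact (Nat.pow_right_injective (le_refl 2 |>.trans (by norm_num)) h).symm

theorem trace_eq_zero_iff {ℓ s : ℕ} (hℓ : ℓ.Prime) (h3 : ℓ ≠ 3)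
    (hroot : orderOf (3 : ZMod (ℓ ^ (s + 1))) = (ℓ ^ (s + 1)).totient)
    (hF : Nat.card F = 3 ^ (ℓ ^ (s + 1)).totient) {η : F} (hη : η ^ ℓ ^ (s + 1) = 1) :
    Algebra.trace (ZMod 3) F η = 0 ↔ η ^ ℓ ≠ 1 ∨ ℓ ≡ 1 [MOD 3] ∧ η = 1 := by
  classical
  have hchar : CharP F 3 := charP_of_injective_algebraMap' (ZMod 3) 3
  have hℓ0 : (ℓ : F) ≠ 0 := by
    rw [Ne, CharP.cast_eq_zero_iff F 3, Nat.prime_dvd_prime_iff_eq Nat.prime_three hℓ]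
    exact h3.symm
  have hroot' : orderOf ((3 : ℕ) : ZMod (ℓ ^ (s + 1))) = (ℓ ^ (s + 1)).totient := by
    exact_mod_cast hroot
  have htr := FiniteField.algebraMap_trace_eq_sum_pow (ZMod 3) F η
  rw [finrank_eq_of_natCard hF, Nat.card_zmod,
    sum_pow_pow_eq_sum_coprime (pow_pos hℓ.pos _) hroot' hη] at htr
  have hsum := sum_coprime_prime_pow_add hℓ s η
  rw [← htr, geom_sum_of_pow_eq_one hη,
    geom_sum_of_pow_eq_one (by rw [← pow_mul, ← pow_succ', hη]), ← eq_sub_iff_add_eq] at hsum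
  rw [← map_eq_zero_iff (algebraMap (ZMod 3) F) (algebraMap (ZMod 3) F).injective, hsum]
  by_cases h1 : η = 1
  · subst h1
    have : (ℓ : F) - 1 = 0 ↔ ℓ ≡ 1 [MOD 3] := by
      rw [← ZMod.natCast_sub_one_eq_zero_iff,
        ← map_eq_zero_iff (algebraMap (ZMod 3) F) (algebraMap (ZMod 3) F).injective]
      simp
    -- As `ℓ` is invertible in `F`, only the factor `ℓ - 1` can vanish.
    have hfac : (ℓ : F) ^ (s + 1) - (ℓ : F) ^ s = ℓ ^ s * (ℓ - 1) := by ring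
    simp [hfac, hℓ0, this]
  · by_cases h2 : η ^ ℓ = 1
    · simp [h1, h2, hℓ0]
    · simp [h1, h2]

/-- Among the `ℓ ^ (s + 1) * k` units, drop the `ℓ * k` with `u ^ (ℓ * k) = 1`, then restore the `k`
with `u ^ k = 1` when `ℓ ≡ 1` mod 3. The form avoids natural subtraction. -/
theorem natCard_definingSet {ℓ s k : ℕ} (hℓ : ℓ.Prime) (h3 : ℓ ≠ 3)
    (hroot : orderOf (3 : ZMod (ℓ ^ (s + 1))) = (ℓ ^ (s + 1)).totient)
    (hF : Nat.card F = 3 ^ (ℓ ^ (s + 1)).totient) (hk : Nat.card F - 1 = ℓ ^ (s + 1) * k) :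
    Nat.card (definingSet F (ℓ ^ (s + 1))) + ℓ * k =
      ℓ ^ (s + 1) * k + if ℓ ≡ 1 [MOD 3] then k else 0 := by
  classical
  have := Fintype.ofFinite F
  have hN : 0 < ℓ ^ (s + 1) := pow_pos hℓ.pos _
  have hdiv : (Nat.card F - 1) / ℓ ^ (s + 1) = k := by rw [hk, Nat.mul_div_cancel_left _ hN]
  have hiff (u : Fˣ) : Algebra.trace (ZMod 3) F ((u : F) ^ k) = 0 ↔
      u ^ (ℓ * k) ≠ 1 ∨ ℓ ≡ 1 [MOD 3] ∧ u ^ k = 1 := by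
    rw [trace_eq_zero_iff hℓ h3 hroot hF]
    · rw [← pow_mul, mul_comm k ℓ, ← Units.val_pow_eq_pow_val, ← Units.val_pow_eq_pow_val, Ne,
        Units.val_eq_one, Units.val_eq_one]
    · rw [← pow_mul, mul_comm, ← hk, ← Units.val_pow_eq_pow_val, ← Nat.card_units, pow_card_eq_one',
        Units.val_one]
  let e : definingSet F (ℓ ^ (s + 1)) ≃
      {u : Fˣ // u ^ (ℓ * k) ≠ 1 ∨ ℓ ≡ 1 [MOD 3] ∧ u ^ k = 1} :=
    { toFun := fun x => ⟨Units.mk0 x.1 x.2.1, (hiff _).1 (by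
        have := x.2.2
        rwa [hdiv] at this)⟩
      invFun := fun u => ⟨u.1, u.1.ne_zero, by rw [hdiv]; exact (hiff _).2 u.2⟩
      left_inv := fun x => rfl
      right_inv := fun u => Subtype.ext (Units.ext rfl) }
  have hcardk := FiniteField.natCard_pow_eq_one (F := F) (k := k) ⟨ℓ ^ (s + 1), by rw [hk, mul_comm]⟩
  have hcardℓk := FiniteField.natCard_pow_eq_one (F := F) (k := ℓ * k) ⟨ℓ ^ s, by rw [hk]; ring⟩
  have htot : Fintype.card Fˣ = ℓ ^ (s + 1) * k := by
    rw [← Nat.card_eq_fintype_card, Nat.card_units, hk]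
  rw [Nat.card_eq_fintype_card, Fintype.card_subtype] at hcardk hcardℓk
  rw [Nat.card_congr e, Nat.card_eq_fintype_card, Fintype.card_subtype, Finset.filter_or,
    Finset.card_union_of_disjoint, ← htot, ← Finset.card_univ,
    ← Finset.card_filter_add_card_filter_not (s := Finset.univ) (fun u : Fˣ => u ^ (ℓ * k) = 1),
    hcardℓk]
  · split_ifs with h
    · simp only [h, true_and, hcardk]
      ring
    · simp [h]
      ring
  · rw [Finset.disjoint_filter]
    rintro u - h ⟨-, hu⟩
    exact h (by rw [mul_comm, pow_mul, hu, one_pow])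

/-! ### Dimension and minimum distance of the dual code -/

theorem dualCode_eq_comap {K : Type*} [Field K] {n : ℕ} (C : Submodule K (Fin n → K)) :
    dualCode C = C.dualAnnihilator.comap (dotProductEquiv K (Fin n)).toLinearMap := by
  ext v
  simp [dualCode, Submodule.mem_dualAnnihilator]

theorem finrank_add_finrank_dualCode {K : Type*} [Field K] {n : ℕ}
    (C : Submodule K (Fin n → K)) :
    Module.finrank K C + Module.finrank K (dualCode C) = n := by
  rw [dualCode_eq_comap, Submodule.comap_equiv_eq_map_symm, LinearEquiv.finrank_map_eq,
    Subspace.finrank_add_finrank_dualAnnihilator_eq, Module.finrank_fin_fun]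

theorem neg_mem_definingSet {F : Type*} [Field F] [Algebra (ZMod 3) F] {N : ℕ}
    (hN : Odd N) (hdvd : N ∣ Nat.card F - 1) (hF : Odd (Nat.card F))
    {x : F} (hx : x ∈ definingSet F N) : -x ∈ definingSet F N := by
  refine ⟨neg_ne_zero.2 hx.1, ?_⟩
  have heven : Even ((Nat.card F - 1) / N) := by
    obtain ⟨k, hk⟩ := hdvd
    have h1 : Even (N * k) := hk ▸ Nat.Odd.sub_odd hF odd_one
    rw [hk, Nat.mul_div_cancel_left _ hN.pos]
    exact (Nat.even_mul.1 h1).resolve_left (Nat.not_even_iff_odd.2 hN)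
  rw [heven.neg_pow]
  exact hx.2

/-- By linearity, pairing `v` with a codeword is a value of the trace form, which is nondegenerate.
-/
theorem mem_dualCode_traceCode {n : ℕ} {d : Fin n → F} {v : Fin n → ZMod 3} :
    v ∈ dualCode (traceCode d) ↔ ∑ i, v i • d i = 0 := by
  have h (x : F) : (v ⬝ᵥ fun i => Algebra.trace (ZMod 3) F (d i * x)) =
      Algebra.traceForm (ZMod 3) F (∑ i, v i • d i) x := by
    simp [dotProduct, Algebra.traceForm_apply]
  constructor
  · intro hv
    refine (traceForm_nondegenerate (ZMod 3) F).1 _ fun x => ?_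
    rw [← h]
    exact hv _ ((mem_traceCode d _).2 ⟨x, rfl⟩)
  · intro hv c hc
    obtain ⟨x, rfl⟩ := (mem_traceCode d c).1 hc
    rw [h, hv, map_zero, LinearMap.zero_apply]

theorem natCard_ker_traceForm {x : F} (hx : x ≠ 0) :
    Nat.card (LinearMap.ker (Algebra.traceForm (ZMod 3) F x)) * 3 = Nat.card F := by
  have hne : Algebra.traceForm (ZMod 3) F x ≠ 0 := fun h =>
    hx ((traceForm_nondegenerate (ZMod 3) F).1 x fun y => by rw [h, LinearMap.zero_apply])
  have hsurj := LinearMap.surjective_of_ne_zero hne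
  rw [Submodule.card_eq_card_quotient_mul_card
    (LinearMap.ker (Algebra.traceForm (ZMod 3) F x)),
    Nat.card_congr ((Algebra.traceForm (ZMod 3) F x).quotKerEquivOfSurjective hsurj).toEquiv,
    Nat.card_zmod]

/-- A nonzero `x` giving the zero word would put all `n` distinct `d i` in a hyperplane of size `q /
3`. -/
theorem finrank_traceCode {n : ℕ} {d : Fin n → F} (hd : Function.Injective d)
    (hn : Nat.card F < 3 * n) :
    Module.finrank (ZMod 3) (traceCode d) = Module.finrank (ZMod 3) F := by
  refine LinearMap.finrank_range_of_inj ((injective_iff_map_eq_zero _).2 fun x hx => ?_)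
  by_contra hx0
  have hmem (i : Fin n) : d i ∈ LinearMap.ker (Algebra.traceForm (ZMod 3) F x) := by
    have := congrFun hx i
    rw [LinearMap.mem_ker, Algebra.traceForm_apply, mul_comm]
    exact this
  have hle := Nat.card_le_card_of_injective
    (fun i => (⟨d i, hmem i⟩ : LinearMap.ker (Algebra.traceForm (ZMod 3) F x)))
    fun i j hij => hd (congrArg Subtype.val hij)
  have := natCard_ker_traceForm hx0
  rw [Nat.card_fin] at hle
  omega

theorem isLeast_hammingDist_dualCode_traceCode {n : ℕ} {d : Fin n → F} (hd0 : ∀ i, d i ≠ 0)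
    {i j : Fin n} (hij : d i + d j = 0) :
    IsLeast {w : ℕ | ∃ c ∈ dualCode (traceCode d), ∃ c' ∈ dualCode (traceCode d),
      c ≠ c' ∧ hammingDist c c' = w} 2 := by
  have : CharP F 3 := charP_of_injective_algebraMap' (ZMod 3) 3
  have hne : i ≠ j := by
    rintro rfl
    have h3 : (3 : F) = 0 := by exact_mod_cast CharP.cast_eq_zero F 3
    exact hd0 i (by linear_combination d i * h3 - hij)
  constructor
  · have hmem : Pi.single i 1 + Pi.single j 1 ∈ dualCode (traceCode d) := by
      rw [mem_dualCode_traceCode]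
      simp [add_smul, Finset.sum_add_distrib, Pi.single_apply, ite_smul, hij]
    have hnorm : hammingNorm (Pi.single i 1 + Pi.single j 1 : Fin n → ZMod 3) = 2 := by
      rw [hammingNorm, ← Finset.card_pair hne]
      congr 1
      ext t
      by_cases hi : t = i <;> by_cases hj : t = j <;> simp_all [Pi.single_apply]
    refine ⟨_, hmem, 0, zero_mem _, fun h => ?_, by rw [hammingDist_zero_right, hnorm]⟩
    rw [h, hammingNorm_zero] at hnorm
    omega
  · rintro w ⟨c, hc, c', hc', hcc, rfl⟩
    by_contra hlt
    have hpos := hammingDist_pos.2 hcc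
    have hone : (Finset.univ.filter fun t => c t ≠ c' t).card = 1 := by
      change hammingDist c c' = 1
      omega
    obtain ⟨t, ht⟩ := Finset.card_eq_one.1 hone
    have hsum := mem_dualCode_traceCode.1 (sub_mem hc hc')
    rw [Finset.sum_eq_single t] at hsum
    · have htm : t ∈ Finset.univ.filter fun t => c t ≠ c' t := by simp [ht]
      rcases smul_eq_zero.1 hsum with h | h
      · exact (Finset.mem_filter.1 htm).2 (sub_eq_zero.1 h)
      · exact hd0 t h
    · intro u _ hu
      have : c u = c' u := by
        by_contra hne'
        have hmem : u ∈ Finset.univ.filter fun t => c t ≠ c' t := by simpa using hne'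
        rw [ht, Finset.mem_singleton] at hmem
        exact hu hmem
      simp [this]
    · simp

end TernaryCode

theorem theorem5p1 (ℓ m q : ℕ) (hℓ : ℓ.Prime) (hodd : Odd ℓ) (hm : 1 < m)
    (hroot : orderOf (3 : ZMod (ℓ ^ m)) = Nat.totient (ℓ ^ m))
    (hq : q = 3 ^ Nat.totient (ℓ ^ m))
    (F : Type*) [Field F] [Finite F] [Algebra (ZMod 3) F] (hF : Nat.card F = q)
    (n : ℕ) (d : Fin n ≃ TernaryCode.definingSet F (ℓ ^ m)) :
    (n : ℚ) = (if ℓ ≡ 1 [MOD 3]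
        then ((q : ℚ) - 1) * ((ℓ : ℚ) ^ m - (ℓ : ℚ) + 1) / (ℓ : ℚ) ^ m
        else ((q : ℚ) - 1) * ((ℓ : ℚ) ^ m - (ℓ : ℚ)) / (ℓ : ℚ) ^ m) ∧
      ℓ ^ (m - 1) * (ℓ - 1) ≤ n ∧
      TernaryCode.IsLinearCode n (n - ℓ ^ (m - 1) * (ℓ - 1)) 2
        (TernaryCode.dualCode (TernaryCode.traceCode fun i => (d i : F))) := by
  classical
  obtain ⟨s, rfl⟩ : ∃ s, m = s + 1 := ⟨m - 1, by omega⟩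
  have hs : 0 < s := by omega
  have hN : 0 < ℓ ^ (s + 1) := pow_pos hℓ.pos _
  have hcop : Nat.Coprime 3 (ℓ ^ (s + 1)) := by
    refine (ZMod.isUnit_iff_coprime 3 (ℓ ^ (s + 1))).1 (IsOfFinOrder.isUnit ?_)
    rw [← orderOf_pos_iff, Nat.cast_ofNat, hroot]
    exact Nat.totient_pos.2 hN
  have h3 : ℓ ≠ 3 := by
    rintro rfl
    exact absurd ((Nat.coprime_pow_right_iff s.succ_pos 3 3).1 hcop) (by decide)
  have h5 : 5 ≤ ℓ := by
    have := hℓ.two_le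
    obtain ⟨t, rfl⟩ := hodd
    omega
  have hqodd : Odd q := hq ▸ Odd.pow (by decide)
  have hqpos : 0 < q := hqodd.pos
  obtain ⟨k, hk⟩ : ℓ ^ (s + 1) ∣ q - 1 :=
    (Nat.modEq_iff_dvd' hqpos).1 (hq ▸ (Nat.ModEq.pow_totient hcop).symm)
  have hq1 : q = ℓ ^ (s + 1) * k + 1 := by omega
  have hk0 : 0 < k := by
    rcases Nat.eq_zero_or_pos k with rfl | h
    · have : 1 < q := hq ▸ Nat.one_lt_pow (Nat.totient_pos.2 hN).ne' (by norm_num)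
      omega
    · exact h
  have hFq : Nat.card F = 3 ^ (ℓ ^ (s + 1)).totient := hF.trans hq
  have hcount := TernaryCode.natCard_definingSet hℓ h3 hroot hFq (hF.symm ▸ hk)
  rw [← Nat.card_congr d, Nat.card_fin] at hcount
  -- Here `m > 1` enters: `ℓ ^ (s + 1) ≥ 5 * ℓ`, so `D` misses at most a fifth of the units.
  have hlarge : q < 3 * n := by
    have h1 : ℓ * 5 ≤ ℓ ^ (s + 1) := by
      rw [pow_succ']
      exact Nat.mul_le_mul_left _ (h5.trans (Nat.le_self_pow hs.ne' ℓ))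
    have h2 := Nat.mul_le_mul_right k h1
    have h4 := Nat.mul_le_mul h5 hk0
    rw [mul_right_comm] at h2
    omega
  have hd0 (i : Fin n) : (d i : F) ≠ 0 := (d i).2.1
  have hrank : Module.finrank (ZMod 3) (TernaryCode.traceCode fun i => (d i : F)) =
      ℓ ^ s * (ℓ - 1) := by
    rw [TernaryCode.finrank_traceCode (d := fun i => (d i : F))
        (Subtype.val_injective.comp d.injective) (hF ▸ hlarge),
      TernaryCode.finrank_eq_of_natCard hFq, Nat.totient_prime_pow_succ hℓ]
  have hdual := TernaryCode.finrank_add_finrank_dualCode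
    (TernaryCode.traceCode fun i => (d i : F))
  rw [hrank] at hdual
  rw [Nat.add_sub_cancel]
  refine ⟨?_, by omega, by omega, ?_⟩
  · have hNQ : (ℓ : ℚ) ^ (s + 1) ≠ 0 := by exact_mod_cast hN.ne'
    have hcQ := congrArg (Nat.cast : ℕ → ℚ) hcount
    have hqQ : (q : ℚ) = (ℓ : ℚ) ^ (s + 1) * k + 1 := by exact_mod_cast hq1
    push_cast at hcQ
    split_ifs with h <;> rw [eq_div_iff hNQ, hqQ]
    · rw [if_pos h] at hcQ
      linear_combination (ℓ : ℚ) ^ (s + 1) * hcQ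
    · rw [if_neg h] at hcQ
      linear_combination (ℓ : ℚ) ^ (s + 1) * hcQ
  · have hn : 0 < n := by omega
    have hneg := TernaryCode.neg_mem_definingSet hodd.pow ⟨k, hF.symm ▸ hk⟩ (hF.symm ▸ hqodd)
      (d ⟨0, hn⟩).2
    exact TernaryCode.isLeast_hammingDist_dualCode_traceCode hd0
      (i := ⟨0, hn⟩) (j := d.symm ⟨_, hneg⟩) (by rw [Equiv.apply_symm_apply, add_neg_cancel])
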